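/- Let $M_n$ be the set of $n\times n$ complex matrices, $\tau$ the trace, and let $c\in M_n$ be self-adjoint. (1) For every $b\in M_n$ the $c$-numerical range $W_c(b)=\{\tau(cu^*bu) : u\in M_n \text{ unitary}\}$ is a convex subset of $\mathbb{C}$. (2) Let $M$ be the convex hull of the unitary orbit $\{u^*cu : u\in M_n\text{ unitary}\}$. Then $M$ is the set of all self-adjoint $a\in M_n$ whose eigenvalues are majorized by those of $c$. That is, if $\lambda_1(a)\ge\dots\ge\lambda_n(a)$ and $\lambda_1(c)\ge\dots\ge\lambda_n(c)$ are the eigenvalues with multiplicity, then $\sum_{i=1}^k\lambda_i(a)\le\sum_{i=1}^k\lambda_i(c)$ for $1\le k\le n$, with equality for $k=n$. (3) The facial dimension of $M$ is at least $3$. Here a face of $M$ is a nonempty convex subset $F\subseteq M$ such that whenever a point of $F$ lies in the open segment between two points of $M$, both of these points lie in $F$; the facial dimension of $M$ is the infimum of the real dimensions of the affine spans of the faces of $M$ that are not singletons. If $c$ is a scalar multiple of the identity, then $M$ is a singleton and the infimum over the empty set is taken to be $\infty$. -/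

import Mathlib

noncomputable section

/-- The dimension of a subset of a real vector space: the dimension of its affine span. -/
def affineDim {E : Type*} [AddCommGroup E] [Module ℝ E] (Q : Set E) : ℕ∞ :=
  Cardinal.toENat (Module.rank ℝ (vectorSpan ℝ Q))

/-- `F` is a (nonempty) face of the convex set `K`: a nonempty convex extreme subset. -/
structure IsConvexFace {E : Type*} [AddCommGroup E] [Module ℝ E] (K F : Set E) : Prop where
  nonempty : F.Nonempty
  convex : Convex ℝ F
  extreme : IsExtreme ℝ K F

/-- The facial dimension of `K`: the infimum of the dimensions of the faces of `K` that
are not singletons. If `K` is a singleton there is no such face and the value is `⊤`. -/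
def facialDim {E : Type*} [AddCommGroup E] [Module ℝ E] (K : Set E) : ℕ∞ :=
  sInf {d : ℕ∞ | ∃ Q : Set E, IsConvexFace K Q ∧ Q.Nontrivial ∧ d = affineDim Q}

/-- The `c`-numerical range `{τ(c u* b u) : u unitary}` of `b`. -/
def cNumericalRange {n : ℕ} (c b : Matrix (Fin n) (Fin n) ℂ) : Set ℂ :=
  {z | ∃ u ∈ Matrix.unitaryGroup (Fin n) ℂ, z = Matrix.trace (c * star u * b * u)}

/-- The unitary orbit `{u* c u : u unitary}` of `c`. -/
def unitaryOrbit {n : ℕ} (c : Matrix (Fin n) (Fin n) ℂ) : Set (Matrix (Fin n) (Fin n) ℂ) :=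
  {a | ∃ u ∈ Matrix.unitaryGroup (Fin n) ℂ, a = star u * c * u}

/-- The eigenvalues of the self-adjoint matrix `a` are majorized by those of `c`. The lists
`Matrix.IsHermitian.eigenvalues₀` contain the eigenvalues with multiplicity in decreasing order;
the sum of the `k` largest eigenvalues of `a` is at most that of `c`, with equality of the sums
of all `n` eigenvalues. -/
def EigenvaluesMajorizedBy {n : ℕ} {a c : Matrix (Fin n) (Fin n) ℂ}
    (ha : a.IsHermitian) (hc : c.IsHermitian) : Prop :=
  (∀ k : ℕ, k ≤ n →
    ∑ i with i.val < k, ha.eigenvalues₀ i ≤ ∑ i with i.val < k, hc.eigenvalues₀ i) ∧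
  ∑ i, ha.eigenvalues₀ i = ∑ i, hc.eigenvalues₀ i

end

open Matrix

/-! Everything rests on one local fact: at a point of the hull `M` outside the orbit, at least three
independent directions stay inside `M` both ways. After diagonalising, the point is a vector `x`
that is a convex combination of permutations of the spectrum of `c`, two distinct ones having
positive weight. Comparing these two gives indices `i ≠ j` for which `E_ii - E_jj` is such a
direction. Rotating the `(i, j)` block then adds the two off-diagonal Hermitian directions: a Bloch
ball lies in `M`.

Distinct orbit points have equal Frobenius norm, so their midpoint leaves the orbit. Hence a
nontrivial face contains a non-orbit point, and its span contains the three directions there. For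
the numerical range, a real-linear map to `ℂ` kills some combination of three directions, so an
extreme point of a fibre in the compact set `M` must lie in the orbit. Orbit and hull thus have the
same image, which is convex.

The majorization description combines Ky Fan's inequality with Rado's theorem on permutations. It
also makes `M` closed and supplies the convex combination above. -/

/-! ### Majorization of real vectors -/

theorem antitone_mul_sum_le_sum_mul (v d : ℕ → ℝ) (n : ℕ) (hv : ∀ i, i < n → v (i + 1) ≤ v i)
    (hd : ∀ k, k ≤ n → 0 ≤ ∑ i ∈ Finset.range k, d i) :
    v n * ∑ i ∈ Finset.range (n + 1), d i ≤ ∑ i ∈ Finset.range (n + 1), v i * d i := by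
  induction n with
  | zero => simp
  | succ n ih =>
    have h1 := ih (fun i hi => hv i (by omega)) (fun k hk => hd k (by omega))
    rw [Finset.sum_range_succ, Finset.sum_range_succ (fun i => v i * d i)]
    -- Lowering the coefficient `v n` to `v (n + 1)` only decreases the product, since the partial
    -- sum is nonnegative.
    have h2 := mul_le_mul_of_nonneg_right (hv n (by omega)) (hd (n + 1) le_rfl)
    linarith

theorem Fin.sum_filter_val_lt {M : Type*} [AddCommMonoid M] {n : ℕ} (f : ℕ → M) {k : ℕ}
    (hk : k ≤ n) :
    ∑ i : Fin n with i.val < k, f i = ∑ i ∈ Finset.range k, f i := by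
  rw [Finset.sum_filter, Fin.sum_univ_eq_sum_range (fun i => if i < k then f i else 0) n,
    ← Finset.sum_filter]
  congr 1
  ext i
  simp
  omega

/-- Abel summation: the pairing with an antitone vector is monotone for majorization. -/
theorem Antitone.sum_mul_le_sum_mul_of_partial_sums {n : ℕ} {v x y : Fin n → ℝ} (hv : Antitone v)
    (h : ∀ k : ℕ, k ≤ n → ∑ i with i.val < k, x i ≤ ∑ i with i.val < k, y i)
    (h' : ∑ i, x i = ∑ i, y i) : ∑ i, v i * x i ≤ ∑ i, v i * y i := by
  rcases n with _ | n
  · simp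
  let V : ℕ → ℝ := fun i => if hi : i < n + 1 then v ⟨i, hi⟩ else 0
  let D : ℕ → ℝ := fun i => if hi : i < n + 1 then y ⟨i, hi⟩ - x ⟨i, hi⟩ else 0
  have hV : ∀ i : Fin (n + 1), V i = v i := fun i => dif_pos i.isLt
  have hD : ∀ i : Fin (n + 1), D i = y i - x i := fun i => dif_pos i.isLt
  have key := antitone_mul_sum_le_sum_mul V D n
    (fun i hi => by
      simp only [V, dif_pos (show i < n + 1 by omega), dif_pos (show i + 1 < n + 1 by omega)]
      exact hv (by simp))
    (fun k hk => by
      rw [← Fin.sum_filter_val_lt D (show k ≤ n + 1 by omega)]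
      simp only [hD, Finset.sum_sub_distrib]
      linarith [h k (by omega)])
  rw [← Fin.sum_univ_eq_sum_range, ← Fin.sum_univ_eq_sum_range (fun i => V i * D i)] at key
  simp only [hV, hD, Finset.sum_sub_distrib, mul_sub] at key
  simp only [h', sub_self] at key
  linarith

/-- **Hardy–Littlewood–Pólya and Rado**: a vector majorized by `y` is a convex combination of
permutations of `y`. -/
theorem mem_convexHull_perm_of_majorized {n : ℕ} {x y : Fin n → ℝ} (hx : Antitone x)
    (h : ∀ k : ℕ, k ≤ n → ∑ i with i.val < k, x i ≤ ∑ i with i.val < k, y i)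
    (h' : ∑ i, x i = ∑ i, y i) :
    x ∈ convexHull ℝ (Set.range fun σ : Equiv.Perm (Fin n) => y ∘ σ) := by
  by_contra hmem
  obtain ⟨f, u, hfs, hfx⟩ := geometric_hahn_banach_closed_point
    (convex_convexHull ℝ (Set.range fun σ : Equiv.Perm (Fin n) => y ∘ σ))
    ((Set.finite_range _).isClosed_convexHull ℝ) hmem
  set w : Fin n → ℝ := fun i => f (Pi.single i 1) with hw
  have hf : ∀ z : Fin n → ℝ, f z = ∑ i, w i * z i := fun z => by
    conv_lhs => rw [pi_eq_sum_univ' z, map_sum]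
    refine Finset.sum_congr rfl fun i _ => ?_
    rw [map_smul, smul_eq_mul, mul_comm]
  -- Sorting the separating functional decreasingly, rearrangement and Abel summation give `f x ≤ f
  -- (y ∘ τ⁻¹)`, against the separation.
  let τ : Equiv.Perm (Fin n) := Tuple.sort (fun i => -w i)
  have hτ : Antitone (w ∘ τ) := fun i j hij => by
    have := Tuple.monotone_sort (fun i => -w i) hij
    simpa [τ] using this
  have h1 : f x = ∑ i, (w ∘ τ) i * (x ∘ τ) i := by
    rw [hf, ← Equiv.sum_comp τ]
    rfl
  have h2 : ∑ i, (w ∘ τ) i * (x ∘ τ) i ≤ ∑ i, (w ∘ τ) i * x i :=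
    (hτ.monovary hx).sum_mul_comp_perm_le_sum_mul (σ := τ)
  have h3 := hτ.sum_mul_le_sum_mul_of_partial_sums h h'
  have h4 : f (y ∘ τ.symm) = ∑ i, (w ∘ τ) i * y i := by
    rw [hf, ← Equiv.sum_comp τ]
    simp
  have h5 := hfs _ (subset_convexHull ℝ _ ⟨τ.symm, rfl⟩)
  linarith

/-- A sum of weights in `[0, 1]` of total mass `k` against an antitone vector is at most the sum
of its `k` first entries. -/
theorem Antitone.sum_mul_le_sum_filter_val_lt {n : ℕ} {y p : Fin n → ℝ} (hy : Antitone y) {k : ℕ}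
    (hk : k ≤ n) (hp0 : ∀ i, 0 ≤ p i) (hp1 : ∀ i, p i ≤ 1) (hp : ∑ i, p i = k) :
    ∑ i, p i * y i ≤ ∑ i with i.val < k, y i := by
  rcases k with _ | k
  · have : ∀ i, p i = 0 := fun i =>
      (Finset.sum_eq_zero_iff_of_nonneg fun i _ => hp0 i).1 (by simpa using hp) i (Finset.mem_univ i)
    simp [this]
  -- The threshold is the last entry kept: weights lose mass above it and gain mass below it. The
  -- total masses agree, so `t` cancels.
  let t := y ⟨k, hk⟩
  have hcount : ∑ i : Fin n, (if i.val < k + 1 then (1 : ℝ) else 0) = ((k + 1 : ℕ) : ℝ) := by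
    rw [← Finset.sum_filter, Fin.sum_filter_val_lt (fun _ => (1 : ℝ)) hk]
    simp
  have hle : ∑ i, (p i - if i.val < k + 1 then (1 : ℝ) else 0) * (y i - t) ≤ 0 := by
    refine Finset.sum_nonpos fun i _ => ?_
    split_ifs with hi
    · refine mul_nonpos_of_nonpos_of_nonneg (by linarith [hp1 i]) (sub_nonneg.2 (hy ?_))
      exact Fin.mk_le_mk.2 (by omega)
    · refine mul_nonpos_of_nonneg_of_nonpos (by linarith [hp0 i]) (sub_nonpos.2 (hy ?_))
      exact Fin.mk_le_mk.2 (by omega)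
  have hexp : ∑ i, (p i - if i.val < k + 1 then (1 : ℝ) else 0) * (y i - t)
      = ∑ i, p i * y i - ∑ i with i.val < k + 1, y i
        - (∑ i, p i - ∑ i : Fin n, (if i.val < k + 1 then (1 : ℝ) else 0)) * t := by
    rw [Finset.sum_filter, sub_mul, Finset.sum_mul, Finset.sum_mul, ← Finset.sum_sub_distrib,
      ← Finset.sum_sub_distrib, ← Finset.sum_sub_distrib]
    refine Finset.sum_congr rfl fun i _ => ?_
    split_ifs <;> ring
  rw [hexp, hp, hcount] at hle
  linarith

/-! ### Two-sided directions at a point of a convex set -/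

section InnerDirections

variable {E : Type*} [AddCommGroup E] [Module ℝ E]

theorem Convex.add_smul_mem_of_le {K : Set E} (hK : Convex ℝ K) {m d : E} (hm : m ∈ K) {ε δ : ℝ}
    (hε : m + ε • d ∈ K) (hδ : 0 ≤ δ) (h : δ ≤ ε) : m + δ • d ∈ K := by
  rcases hδ.eq_or_lt with rfl | hδ
  · simpa using hm
  have h1 := hK.add_smul_mem hm hε (t := δ / ε) ⟨div_nonneg hδ.le (by linarith), (div_le_one (by linarith)).2 h⟩
  rwa [smul_smul, div_mul_cancel₀ _ (by linarith)] at h1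

/-- The directions in which one can move from `m` both ways inside the convex set `K`. -/
def Convex.innerDirections {K : Set E} (hK : Convex ℝ K) {m : E} (hm : m ∈ K) :
    Submodule ℝ E where
  carrier := {d | ∃ ε : ℝ, 0 < ε ∧ m + ε • d ∈ K ∧ m + ε • (-d) ∈ K}
  zero_mem' := ⟨1, one_pos, by simpa using hm, by simpa using hm⟩
  add_mem' := by
    rintro d d' ⟨ε, hε, h1, h2⟩ ⟨δ, hδ, h3, h4⟩
    have key : ∀ a b : E, m + ε • a ∈ K → m + δ • b ∈ K →
        m + (min ε δ / 2) • (a + b) ∈ K := fun a b ha hb => by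
      have hp : 0 ≤ min ε δ := (lt_min hε hδ).le
      have := hK (hK.add_smul_mem_of_le hm ha hp (min_le_left _ _))
        (hK.add_smul_mem_of_le hm hb hp (min_le_right _ _))
        (show (0 : ℝ) ≤ 1 / 2 by norm_num) (show (0 : ℝ) ≤ 1 / 2 by norm_num) (by norm_num)
      convert this using 1
      module
    refine ⟨min ε δ / 2, half_pos (lt_min hε hδ), key _ _ h1 h3, ?_⟩
    rw [neg_add]
    exact key _ _ h2 h4
  smul_mem' := by
    rintro c d ⟨ε, hε, h1, h2⟩
    rcases lt_trichotomy c 0 with hc | rfl | hc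
    · have hc0 := hc.ne
      refine ⟨ε / (-c), div_pos hε (by linarith), ?_, ?_⟩
      · convert h2 using 2
        rw [smul_smul, smul_neg, ← neg_smul]
        congr 1
        field_simp [hc0]
      · convert h1 using 2
        rw [← neg_smul, smul_smul]
        congr 1
        field_simp [hc0]
    · exact ⟨1, one_pos, by simpa using hm, by simpa using hm⟩
    · refine ⟨ε / c, div_pos hε hc, ?_, ?_⟩
      · convert h1 using 2
        rw [smul_smul, div_mul_cancel₀ _ hc.ne']
      · convert h2 using 2
        rw [← smul_neg, smul_smul, div_mul_cancel₀ _ hc.ne']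

variable {K : Set E} (hK : Convex ℝ K)

/-- Prolong the segment from `x` through `m` to a point `y` of `K`. The contraction towards `y` of
ratio `ε / (1 + ε)` sends `x` to `m` and carries segments around `x` to segments around `m`. -/
theorem Convex.innerDirections_le {m x : E} (hm : m ∈ K) (hx : x ∈ K)
    (h : x - m ∈ hK.innerDirections hm) : hK.innerDirections hx ≤ hK.innerDirections hm := by
  obtain ⟨ε, hε, -, hy⟩ := h
  rintro d ⟨δ, hδ, h1, h2⟩
  have key : ∀ a : E, x + δ • a ∈ K → m + (ε / (1 + ε) * δ) • a ∈ K := fun a ha => by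
    have := hK ha hy (show 0 ≤ ε / (1 + ε) by positivity) (show 0 ≤ 1 / (1 + ε) by positivity)
      (by field_simp; ring)
    convert this using 1
    match_scalars <;> field_simp
    ring
  exact ⟨_, by positivity, key _ h1, key _ h2⟩

theorem Convex.sub_mem_innerDirections_of_mem_openSegment {m x y : E} (hm : m ∈ K) (hx : x ∈ K)
    (hy : y ∈ K) (h : m ∈ openSegment ℝ x y) : x - m ∈ hK.innerDirections hm := by
  obtain ⟨a, b, ha, hb, hab, rfl⟩ := h
  obtain rfl : b = 1 - a := by linarith
  -- A forward step of `1` reaches `x`; a backward step of `a / (1 - a)` reaches `y`.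
  refine ⟨min 1 (a / (1 - a)), lt_min one_pos (by positivity), ?_, ?_⟩
  · refine hK.add_smul_mem_of_le hm (ε := 1) ?_ (lt_min one_pos (by positivity)).le (min_le_left _ _)
    simpa using hx
  · refine hK.add_smul_mem_of_le hm (ε := a / (1 - a)) ?_ (lt_min one_pos (by positivity)).le
      (min_le_right _ _)
    convert hy using 1
    match_scalars <;> field_simp <;> ring

/-- `m` lies strictly between `z i` and the centre of mass of the other points, unless these carry
no weight and `m = z i`. -/
theorem Convex.sub_mem_innerDirections_of_sum_eq {ι : Type*} [Fintype ι] {m : E} (hm : m ∈ K)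
    {w : ι → ℝ} {z : ι → E} (hw : ∀ i, 0 ≤ w i) (hw1 : ∑ i, w i = 1) (hz : ∀ i, z i ∈ K)
    (h : ∑ i, w i • z i = m) {i : ι} (hi : 0 < w i) : z i - m ∈ hK.innerDirections hm := by
  classical
  rw [← Finset.add_sum_erase _ _ (Finset.mem_univ i)] at hw1 h
  set s := ∑ j ∈ Finset.univ.erase i, w j with hs
  have hs0 : 0 ≤ s := Finset.sum_nonneg fun j _ => hw j
  rcases hs0.eq_or_lt with h0 | h0
  · have hz0 : ∑ j ∈ Finset.univ.erase i, w j • z j = 0 :=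
      Finset.sum_eq_zero fun j hj => by
        rw [(Finset.sum_eq_zero_iff_of_nonneg fun j _ => hw j).1 h0.symm j hj, zero_smul]
    have hi1 : w i = 1 := by linarith
    rw [hz0, hi1, one_smul, add_zero] at h
    rw [h, sub_self]
    exact Submodule.zero_mem _
  · refine hK.sub_mem_innerDirections_of_mem_openSegment hm (hz i)
      (hK.centerMass_mem (t := Finset.univ.erase i) (fun j _ => hw j) h0 fun j _ => hz j)
      ⟨w i, s, hi, h0, hw1, ?_⟩
    rw [Finset.centerMass, ← hs, smul_smul, mul_inv_cancel₀ h0.ne', one_smul, h]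

theorem Convex.innerDirections_le_vectorSpan {Q : Set E} (hQ : IsExtreme ℝ K Q) {m : E}
    (hm : m ∈ K) (hmQ : m ∈ Q) : hK.innerDirections hm ≤ vectorSpan ℝ Q := by
  rintro d ⟨ε, hε, h1, h2⟩
  have hx : m + ε • d ∈ Q := hQ.left_mem_of_mem_openSegment h1 h2 hmQ
    ⟨1 / 2, 1 / 2, by norm_num, by norm_num, by norm_num, by module⟩
  have := vsub_mem_vectorSpan ℝ hx hmQ
  rw [vsub_eq_sub, add_sub_cancel_left] at this
  exact (Submodule.smul_mem_iff _ hε.ne').1 this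

end InnerDirections

/-! ### The unitary orbit, its hull and majorization -/

section Orbit

variable {n : ℕ}

/-- Conjugation `a ↦ u* a u` as a real-linear map. -/
def conjLinear (u : Matrix (Fin n) (Fin n) ℂ) :
    Matrix (Fin n) (Fin n) ℂ →ₗ[ℝ] Matrix (Fin n) (Fin n) ℂ where
  toFun a := star u * a * u
  map_add' a b := by rw [mul_add, add_mul]
  map_smul' r a := by simp

theorem conjLinear_apply (u a : Matrix (Fin n) (Fin n) ℂ) : conjLinear u a = star u * a * u := rfl

theorem conjLinear_mul (u v a : Matrix (Fin n) (Fin n) ℂ) :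
    conjLinear v (conjLinear u a) = conjLinear (u * v) a := by
  simp [conjLinear_apply, mul_assoc]

theorem conjLinear_star_conjLinear {u : Matrix (Fin n) (Fin n) ℂ}
    (hu : u ∈ unitaryGroup (Fin n) ℂ) (a : Matrix (Fin n) (Fin n) ℂ) :
    conjLinear (star u) (conjLinear u a) = a := by
  rw [conjLinear_mul, mem_unitaryGroup_iff.1 hu, conjLinear_apply]
  simp

theorem mem_unitaryOrbit_self (c : Matrix (Fin n) (Fin n) ℂ) : c ∈ unitaryOrbit c :=
  ⟨1, one_mem _, by simp⟩

theorem conjLinear_mem_unitaryOrbit {c a u : Matrix (Fin n) (Fin n) ℂ} (ha : a ∈ unitaryOrbit c)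
    (hu : u ∈ unitaryGroup (Fin n) ℂ) : conjLinear u a ∈ unitaryOrbit c := by
  obtain ⟨v, hv, rfl⟩ := ha
  exact ⟨v * u, mul_mem hv hu, conjLinear_mul v u c⟩

theorem conjLinear_mem_unitaryOrbit_iff {c a u : Matrix (Fin n) (Fin n) ℂ}
    (hu : u ∈ unitaryGroup (Fin n) ℂ) : conjLinear u a ∈ unitaryOrbit c ↔ a ∈ unitaryOrbit c := by
  refine ⟨fun h => ?_, fun h => conjLinear_mem_unitaryOrbit h hu⟩
  simpa [conjLinear_star_conjLinear hu] using
    conjLinear_mem_unitaryOrbit h (Unitary.star_mem hu)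

theorem unitaryOrbit_eq_of_mem {c d : Matrix (Fin n) (Fin n) ℂ} (hd : d ∈ unitaryOrbit c) :
    unitaryOrbit d = unitaryOrbit c := by
  ext a
  constructor
  · rintro ⟨v, hv, rfl⟩
    exact conjLinear_mem_unitaryOrbit hd hv
  · rintro ⟨v, hv, rfl⟩
    obtain ⟨u, hu, rfl⟩ := hd
    refine (conjLinear_mem_unitaryOrbit_iff hv).2 ?_
    exact (conjLinear_mem_unitaryOrbit_iff hu).1 (mem_unitaryOrbit_self _)

theorem conjLinear_mem_convexHull {c a u : Matrix (Fin n) (Fin n) ℂ}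
    (ha : a ∈ convexHull ℝ (unitaryOrbit c)) (hu : u ∈ unitaryGroup (Fin n) ℂ) :
    conjLinear u a ∈ convexHull ℝ (unitaryOrbit c) := by
  have h := Set.mem_image_of_mem (conjLinear u) ha
  rw [LinearMap.image_convexHull] at h
  refine convexHull_mono ?_ h
  rintro _ ⟨x, hx, rfl⟩
  exact conjLinear_mem_unitaryOrbit hx hu

theorem conjLinear_mem_convexHull_iff {c a u : Matrix (Fin n) (Fin n) ℂ}
    (hu : u ∈ unitaryGroup (Fin n) ℂ) :
    conjLinear u a ∈ convexHull ℝ (unitaryOrbit c) ↔ a ∈ convexHull ℝ (unitaryOrbit c) := by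
  refine ⟨fun h => ?_, fun h => conjLinear_mem_convexHull h hu⟩
  simpa [conjLinear_star_conjLinear hu] using
    conjLinear_mem_convexHull h (Unitary.star_mem hu)

theorem isHermitian_of_mem_convexHull {c a : Matrix (Fin n) (Fin n) ℂ} (hc : c.IsHermitian)
    (ha : a ∈ convexHull ℝ (unitaryOrbit c)) : a.IsHermitian := by
  refine convexHull_min (t := (selfAdjoint.submodule ℝ (Matrix (Fin n) (Fin n) ℂ) : Set _))
    ?_ (Submodule.convex _) ha
  rintro _ ⟨u, hu, rfl⟩
  exact isHermitian_conjTranspose_mul_mul u hc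

/-- The diagonal matrix with prescribed real entries, as a linear map. -/
def realDiagonal (n : ℕ) : (Fin n → ℝ) →ₗ[ℝ] Matrix (Fin n) (Fin n) ℂ where
  toFun x := diagonal fun i => (x i : ℂ)
  map_add' x y := by simp
  map_smul' r x := by ext i j; by_cases h : i = j <;> simp [h]

theorem realDiagonal_apply (x : Fin n → ℝ) : realDiagonal n x = diagonal fun i => (x i : ℂ) := rfl

theorem realDiagonal_perm_mem_unitaryOrbit (x : Fin n → ℝ) (σ : Equiv.Perm (Fin n)) :
    realDiagonal n (x ∘ σ) ∈ unitaryOrbit (realDiagonal n x) := by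
  have hstar : star ((1 : Matrix (Fin n) (Fin n) ℂ).submatrix id σ) =
      (1 : Matrix (Fin n) (Fin n) ℂ).submatrix σ id := by
    rw [star_eq_conjTranspose, conjTranspose_submatrix, conjTranspose_one]
  refine ⟨(1 : Matrix (Fin n) (Fin n) ℂ).submatrix id σ, ?_, ?_⟩
  · rw [mem_unitaryGroup_iff', hstar, ← submatrix_mul _ _ _ _ _ Function.bijective_id, one_mul]
    exact submatrix_one_equiv σ
  · have h : realDiagonal n x = (realDiagonal n x).submatrix id id := rfl
    rw [hstar, h, ← submatrix_mul _ _ _ _ _ Function.bijective_id, one_mul,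
      ← submatrix_mul _ _ _ _ _ Function.bijective_id, mul_one, realDiagonal_apply,
      realDiagonal_apply, submatrix_diagonal_equiv]
    rfl

/-- The eigenvalues of a Hermitian matrix in decreasing order, indexed by `Fin n`. -/
noncomputable def Matrix.IsHermitian.sortedEigenvalues {a : Matrix (Fin n) (Fin n) ℂ} (ha : a.IsHermitian) :
    Fin n → ℝ :=
  fun i => ha.eigenvalues₀ (Fin.cast (Fintype.card_fin n).symm i)

theorem Matrix.IsHermitian.sortedEigenvalues_antitone {a : Matrix (Fin n) (Fin n) ℂ}
    (ha : a.IsHermitian) : Antitone ha.sortedEigenvalues :=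
  fun _ _ h => ha.eigenvalues₀_antitone h

theorem eigenvaluesMajorizedBy_iff {a c : Matrix (Fin n) (Fin n) ℂ} (ha : a.IsHermitian)
    (hc : c.IsHermitian) :
    EigenvaluesMajorizedBy ha hc ↔
      (∀ k : ℕ, k ≤ n → ∑ i with i.val < k, ha.sortedEigenvalues i ≤
        ∑ i with i.val < k, hc.sortedEigenvalues i) ∧
      ∑ i, ha.sortedEigenvalues i = ∑ i, hc.sortedEigenvalues i := by
  have h1 : ∀ {b : Matrix (Fin n) (Fin n) ℂ} (hb : b.IsHermitian),
      ∑ i, hb.sortedEigenvalues i = ∑ i, hb.eigenvalues₀ i := fun hb =>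
    Equiv.sum_comp (finCongr (Fintype.card_fin n).symm) hb.eigenvalues₀
  have h2 : ∀ {b : Matrix (Fin n) (Fin n) ℂ} (hb : b.IsHermitian) (k : ℕ),
      ∑ i with i.val < k, hb.sortedEigenvalues i = ∑ i with i.val < k, hb.eigenvalues₀ i :=
    fun hb k => by
      rw [Finset.sum_filter, Finset.sum_filter]
      exact Equiv.sum_comp (finCongr (Fintype.card_fin n).symm)
        (fun i => if i.val < k then hb.eigenvalues₀ i else 0)
  simp only [EigenvaluesMajorizedBy, h1, h2]

theorem Matrix.IsHermitian.exists_eq_conjLinear {a : Matrix (Fin n) (Fin n) ℂ}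
    (ha : a.IsHermitian) : ∃ u ∈ unitaryGroup (Fin n) ℂ,
      a = conjLinear u (realDiagonal n ha.sortedEigenvalues) := by
  have h0 : realDiagonal n ha.eigenvalues ∈ unitaryOrbit (realDiagonal n ha.sortedEigenvalues) := by
    -- `eigenvalues` is `eigenvalues₀` reindexed along a bijection that need not preserve order; a
    -- permutation matrix absorbs the discrepancy.
    have := realDiagonal_perm_mem_unitaryOrbit ha.sortedEigenvalues
      ((Fintype.equivOfCardEq (Fintype.card_fin _)).symm.trans (finCongr (Fintype.card_fin n)))
    exact this
  obtain ⟨u, hu, h⟩ : a ∈ unitaryOrbit (realDiagonal n ha.eigenvalues) := by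
    refine ⟨star (ha.eigenvectorUnitary : Matrix (Fin n) (Fin n) ℂ),
      Unitary.star_mem ha.eigenvectorUnitary.2, ?_⟩
    rw [star_star]
    exact ha.spectral_theorem
  have := conjLinear_mem_unitaryOrbit h0 hu
  rw [conjLinear_apply, ← h] at this
  exact this

theorem Matrix.IsHermitian.unitaryOrbit_eq {c : Matrix (Fin n) (Fin n) ℂ} (hc : c.IsHermitian) :
    unitaryOrbit c = unitaryOrbit (realDiagonal n hc.sortedEigenvalues) := by
  obtain ⟨u, hu, h⟩ := hc.exists_eq_conjLinear
  exact unitaryOrbit_eq_of_mem ⟨u, hu, h⟩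

/-- **Ky Fan**: the first `k` diagonal entries of a point of the convex hull of the unitary orbit
of a decreasing diagonal matrix. -/
theorem sum_re_diag_le {y : Fin n → ℝ} (hy : Antitone y) {a : Matrix (Fin n) (Fin n) ℂ}
    (ha : a ∈ convexHull ℝ (unitaryOrbit (realDiagonal n y))) {k : ℕ} (hk : k ≤ n) :
    ∑ i with i.val < k, (a i i).re ≤ ∑ i with i.val < k, y i := by
  refine convexHull_min (t := {a | ∑ i with i.val < k, (a i i).re ≤ ∑ i with i.val < k, y i})
    ?_ ?_ ha
  · rintro _ ⟨u, hu, rfl⟩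
    have hentry : ∀ i, ((star u * realDiagonal n y * u) i i).re
        = ∑ j, Complex.normSq (u j i) * y j := fun i => by
      rw [realDiagonal_apply, mul_apply, Complex.re_sum]
      refine Finset.sum_congr rfl fun j _ => ?_
      rw [mul_diagonal, star_apply, Complex.star_def, mul_right_comm,
        ← Complex.normSq_eq_conj_mul_self, ← Complex.ofReal_mul, Complex.ofReal_re]
    have hrow : ∀ j, ∑ i, Complex.normSq (u j i) = 1 := fun j => by
      have := congrFun₂ (mem_unitaryGroup_iff.1 hu) j j
      rw [mul_apply, one_apply_eq] at this
      have h2 := congrArg Complex.re this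
      rw [Complex.re_sum, Complex.one_re] at h2
      rw [← h2]
      refine Finset.sum_congr rfl fun i _ => ?_
      rw [star_apply, Complex.star_def, Complex.mul_conj, Complex.ofReal_re]
    have hcol : ∀ i, ∑ j, Complex.normSq (u j i) = 1 := fun i => by
      have := congrFun₂ (mem_unitaryGroup_iff'.1 hu) i i
      rw [mul_apply, one_apply_eq] at this
      have h2 := congrArg Complex.re this
      rw [Complex.re_sum, Complex.one_re] at h2
      rw [← h2]
      refine Finset.sum_congr rfl fun j _ => ?_
      rw [star_apply, Complex.star_def, ← Complex.normSq_eq_conj_mul_self, Complex.ofReal_re]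
    simp only [Set.mem_ofPred_eq, hentry]
    rw [Finset.sum_comm]
    simp only [← Finset.sum_mul]
    -- The weight of `y j` is the sum of `|u j i|²` over `i < k`: at most `1` by the unit rows, of
    -- total `k` by the unit columns.
    refine hy.sum_mul_le_sum_filter_val_lt hk
      (fun j => Finset.sum_nonneg fun i _ => Complex.normSq_nonneg _) (fun j => ?_) ?_
    · rw [← hrow j]
      exact Finset.sum_le_sum_of_subset_of_nonneg (Finset.filter_subset _ _)
        fun i _ _ => Complex.normSq_nonneg _
    · rw [Finset.sum_comm]
      simp only [hcol]
      rw [Fin.sum_filter_val_lt (fun _ => (1 : ℝ)) hk]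
      simp
  · intro a ha b hb s t hs ht hst
    simp only [Set.mem_ofPred_eq, Matrix.add_apply, Matrix.smul_apply, Complex.add_re, Complex.real_smul,
      Complex.re_ofReal_mul, Finset.sum_add_distrib, ← Finset.mul_sum] at ha hb ⊢
    have h1 := mul_le_mul_of_nonneg_left ha hs
    have h2 := mul_le_mul_of_nonneg_left hb ht
    calc _ ≤ s * _ + t * _ := add_le_add h1 h2
      _ = _ := by rw [← add_mul, hst, one_mul]

theorem trace_eq_of_mem_convexHull {c a : Matrix (Fin n) (Fin n) ℂ}
    (ha : a ∈ convexHull ℝ (unitaryOrbit c)) : a.trace = c.trace := by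
  refine convexHull_min (t := {a | a.trace = c.trace}) ?_ ?_ ha
  · rintro _ ⟨u, hu, rfl⟩
    rw [Set.mem_ofPred_eq, mul_assoc, trace_mul_comm, mul_assoc, mem_unitaryGroup_iff.1 hu, mul_one]
  · intro a ha b hb s t hs ht hst
    simp only [Set.mem_ofPred_eq, trace_add, trace_smul] at ha hb ⊢
    rw [ha, hb, ← add_smul, hst, one_smul]

/-- Necessity is Ky Fan plus invariance of the trace; sufficiency is Rado, permutations being
realised in the orbit. -/
theorem realDiagonal_mem_convexHull_iff {x y : Fin n → ℝ} (hx : Antitone x) (hy : Antitone y) :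
    realDiagonal n x ∈ convexHull ℝ (unitaryOrbit (realDiagonal n y)) ↔
      (∀ k : ℕ, k ≤ n → ∑ i with i.val < k, x i ≤ ∑ i with i.val < k, y i) ∧
        ∑ i, x i = ∑ i, y i := by
  constructor
  · intro h
    refine ⟨fun k hk => ?_, ?_⟩
    · simpa [realDiagonal_apply] using sum_re_diag_le hy h hk
    · have := trace_eq_of_mem_convexHull h
      simp only [realDiagonal_apply, trace_diagonal] at this
      exact_mod_cast this
  · rintro ⟨h1, h2⟩
    have h := Set.mem_image_of_mem (realDiagonal n) (mem_convexHull_perm_of_majorized hx h1 h2)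
    rw [LinearMap.image_convexHull] at h
    refine convexHull_mono ?_ h
    rintro _ ⟨_, ⟨σ, rfl⟩, rfl⟩
    exact realDiagonal_perm_mem_unitaryOrbit y σ

theorem convexHull_unitaryOrbit_eq {c : Matrix (Fin n) (Fin n) ℂ} (hc : c.IsHermitian) :
    convexHull ℝ (unitaryOrbit c) =
      {a : Matrix (Fin n) (Fin n) ℂ | ∃ ha : a.IsHermitian, EigenvaluesMajorizedBy ha hc} := by
  have key : ∀ {a : Matrix (Fin n) (Fin n) ℂ} (ha : a.IsHermitian),
      a ∈ convexHull ℝ (unitaryOrbit c) ↔ EigenvaluesMajorizedBy ha hc := fun {a} ha => by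
    rw [eigenvaluesMajorizedBy_iff, ← realDiagonal_mem_convexHull_iff
      ha.sortedEigenvalues_antitone hc.sortedEigenvalues_antitone, ← hc.unitaryOrbit_eq]
    obtain ⟨u, hu, h⟩ := ha.exists_eq_conjLinear
    rw [← conjLinear_mem_convexHull_iff (a := realDiagonal n _) hu, ← h]
  ext a
  exact ⟨fun h => ⟨isHermitian_of_mem_convexHull hc h, (key _).1 h⟩, fun ⟨ha, h⟩ => (key ha).2 h⟩

end Orbit

/-! ### Rotations in a two-dimensional block -/

section TwoLevel

variable {n : ℕ}

/-- The off-diagonal Hermitian matrix `ζ E_ij + ζ̄ E_ji`. -/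
def offDiagonalPair (i j : Fin n) (ζ : ℂ) : Matrix (Fin n) (Fin n) ℂ :=
  single i j ζ + single j i (star ζ)

theorem offDiagonalPair_neg (i j : Fin n) (ζ : ℂ) :
    offDiagonalPair i j (-ζ) = -offDiagonalPair i j ζ := by
  simp only [offDiagonalPair, star_neg, single_neg, neg_add]

theorem realDiagonal_single (i : Fin n) (r : ℝ) :
    realDiagonal n (Pi.single i r) = single i i (r : ℂ) := by
  ext a b
  by_cases h : a = b
  · subst h
    by_cases h' : i = a
    · subst h'; simp [realDiagonal_apply]
    · simp [realDiagonal_apply, h', Ne.symm h']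
  · by_cases h' : i = a
    · subst h'; simp [realDiagonal_apply, h]
    · simp [realDiagonal_apply, h, h']

/-- With `P` the projection onto a plane and `A` a quarter turn of it, `1 - P + s • (P + A)` for `s
= 1/√2` is the rotation by `π/4`. It fixes `O`, which is scalar on the plane, and turns the
Pauli-type element `Z` into `X`. -/
theorem conj_eq_of_relations {R : Type*} [Ring R] [Algebra ℝ R] [StarRing R] [StarModule ℝ R]
    {P A Z X O : R} {s : ℝ} {t : ℝ} (hs : s * s = 1 / 2) (hPs : star P = P) (hAs : star A = -A)
    (hPP : P * P = P) (hPA : P * A = A) (hAP : A * P = A) (hAA : A * A = -P)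
    (hPZ : P * Z = Z) (hZP : Z * P = Z) (hXP : X * P = X) (hAZ : A * Z = -X)
    (hZA : Z * A = X) (hXA : X * A = -Z) (hOP : O * P = t • P) (hPO : P * O = t • P)
    (hOA : O * A = t • A) (hAO : A * O = t • A) :
    star (1 - P + s • (P + A)) * (1 - P + s • (P + A)) = 1 ∧
    star (1 - P + s • (P + A)) * O * (1 - P + s • (P + A)) = O ∧
    star (1 - P + s • (P + A)) * Z * (1 - P + s • (P + A)) = X := by
  have hU : star (1 - P + s • (P + A)) = 1 - P + s • (P - A) := by
    simp [hPs, hAs, sub_eq_add_neg]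
  have h1 : star (1 - P + s • (P + A)) * (1 - P + s • (P + A)) = 1 := by
    rw [hU]
    simp only [mul_add, add_mul, mul_sub, sub_mul, smul_mul_assoc, mul_smul_comm, smul_add,
      smul_sub, smul_smul, hs, hPP, hPA, hAP, hAA, mul_one, one_mul]
    module
  have hO : O * (1 - P + s • (P + A)) = (1 - P + s • (P + A)) * O := by
    simp only [mul_add, add_mul, mul_sub, sub_mul, smul_mul_assoc, mul_smul_comm, hOP, hPO, hOA,
      hAO, mul_one, one_mul]
  refine ⟨h1, ?_, ?_⟩
  · rw [mul_assoc, hO, ← mul_assoc, h1, one_mul]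
  · rw [hU]
    have h2 : (1 - P + s • (P - A)) * Z = s • (Z + X) := by
      simp only [add_mul, sub_mul, smul_mul_assoc, hPZ, hAZ, one_mul]
      module
    rw [h2]
    simp only [mul_add, add_mul, mul_sub, smul_mul_assoc, mul_smul_comm, smul_add,
      smul_smul, hs, hZP, hXP, hZA, hXA, mul_one, smul_neg]
    module

/-- The `(i, j)` block of the diagonal matrix is its mean plus `(x i - x j) / 2` times `diag(1,
-1)`. A rotation of the block replaces the latter by the off-diagonal pair of phase `ζ`. -/
theorem diagonal_add_offDiagonalPair_mem_unitaryOrbit (x : Fin n → ℝ) {i j : Fin n} (hij : i ≠ j)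
    {ζ : ℂ} (hζ : ζ * star ζ = 1) :
    realDiagonal n x - ((x i - x j) / 2) • realDiagonal n (Pi.single i 1 - Pi.single j 1) +
      ((x i - x j) / 2) • offDiagonalPair i j ζ ∈ unitaryOrbit (realDiagonal n x) := by
  set r := (x i - x j) / 2 with hr
  have hζ' : star ζ * ζ = 1 := by rw [mul_comm, hζ]
  have hji : j ≠ i := hij.symm
  set O := realDiagonal n x - r • realDiagonal n (Pi.single i 1 - Pi.single j 1) with hO
  have hZ : realDiagonal n (Pi.single i 1 - Pi.single j 1) = single i i 1 - single j j (1 : ℂ) := by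
    rw [map_sub, realDiagonal_single, realDiagonal_single, Complex.ofReal_one]
  have hOd : O = realDiagonal n (x - r • (Pi.single i 1 - Pi.single j 1)) := by
    rw [hO, map_sub (realDiagonal n) x, map_smul]
  set o := x - r • (Pi.single i 1 - Pi.single j 1) with ho
  have hoi : o i = (x i + x j) / 2 := by simp [ho, hij, hr]; ring
  have hoj : o j = (x i + x j) / 2 := by simp [ho, hji, hr]; ring
  have hs : (√2)⁻¹ * (√2)⁻¹ = 1 / 2 := by
    rw [← mul_inv, Real.mul_self_sqrt (by norm_num), one_div]
  have hmulO : ∀ (k l : Fin n) (z : ℂ), O * single k l z = single k l ((o k : ℂ) * z) :=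
    fun k l z => by
      rw [hOd, realDiagonal_apply]
      ext a b
      by_cases ha : k = a
      · subst ha; by_cases hb : l = b <;> simp [diagonal_mul, hb]
      · simp [diagonal_mul, ha]
  have hOmul : ∀ (k l : Fin n) (z : ℂ), single k l z * O = single k l ((o l : ℂ) * z) :=
    fun k l z => by
      rw [hOd, realDiagonal_apply]
      ext a b
      by_cases hb : l = b
      · subst hb; by_cases ha : k = a <;> simp [mul_diagonal, ha, mul_comm]
      · simp [mul_diagonal, hb]
  obtain ⟨P, hP⟩ : ∃ P : Matrix (Fin n) (Fin n) ℂ, P = single i i 1 + single j j 1 := ⟨_, rfl⟩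
  obtain ⟨A, hA⟩ : ∃ A : Matrix (Fin n) (Fin n) ℂ, A = single i j ζ - single j i (star ζ) :=
    ⟨_, rfl⟩
  obtain ⟨Z, hZ'⟩ : ∃ Z : Matrix (Fin n) (Fin n) ℂ, Z = single i i 1 - single j j 1 := ⟨_, rfl⟩
  obtain ⟨X, hX⟩ : ∃ X : Matrix (Fin n) (Fin n) ℂ, X = offDiagonalPair i j ζ := ⟨_, rfl⟩
  obtain ⟨hPP, hPA, hAP, hAA, hPZ, hZP, hXP, hAZ, hZA, hXA⟩ : P * P = P ∧ P * A = A ∧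
      A * P = A ∧ A * A = -P ∧ P * Z = Z ∧ Z * P = Z ∧ X * P = X ∧ A * Z = -X ∧ Z * A = X ∧
      X * A = -Z := by
    simp only [hP, hA, hZ', hX, offDiagonalPair, mul_add, add_mul, mul_sub, sub_mul,
      single_mul_single_same, ne_eq, hij, hji, not_false_eq_true, single_mul_single_of_ne, hζ, hζ',
      one_mul, mul_one]
    refine ⟨?_, ?_, ?_, ?_, ?_, ?_, ?_, ?_, ?_, ?_⟩ <;> abel
  obtain ⟨h1, h2, h3⟩ := conj_eq_of_relations (O := O) (t := (x i + x j) / 2) hs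
    (by simp [hP, star_eq_conjTranspose]) (by simp [hA, star_eq_conjTranspose])
    hPP hPA hAP hAA hPZ hZP hXP hAZ hZA hXA
    (by simp [hP, mul_add, hmulO, hoi, hoj, smul_single])
    (by simp [hP, add_mul, hOmul, hoi, hoj, smul_single])
    (by simp [hA, mul_sub, hmulO, hoi, hoj, smul_single, smul_sub])
    (by simp [hA, sub_mul, hOmul, hoi, hoj, smul_single, smul_sub])
  refine ⟨_, mem_unitaryGroup_iff'.2 h1, ?_⟩
  rw [show realDiagonal n x = O + r • Z by rw [hO, hZ, ← hZ', sub_add_cancel]]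
  generalize 1 - P + (√2)⁻¹ • (P + A) = U at h2 h3
  rw [mul_add, add_mul, h2, mul_smul_comm, smul_mul_assoc, h3, hX]

theorem linearIndependent_twoLevel {i j : Fin n} (hij : i ≠ j) :
    LinearIndependent ℝ ![realDiagonal n (Pi.single i 1 - Pi.single j 1), offDiagonalPair i j 1,
      offDiagonalPair i j Complex.I] := by
  rw [Fintype.linearIndependent_iff]
  intro g hg
  simp only [Fin.sum_univ_three, Fin.isValue, cons_val, map_sub, realDiagonal_single] at hg
  have h1 := congrFun₂ hg i i
  have h2 := congrFun₂ hg i j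
  simp [offDiagonalPair, hij, hij.symm] at h1 h2
  have h3 := congrArg Complex.re h2
  have h4 := congrArg Complex.im h2
  simp at h3 h4
  intro k
  fin_cases k <;> simp [h1, h3, h4]

/-- Swapping `i` and `j` moves the two rearrangements in opposite directions along `e_i - e_j`. To
find them, take the largest value `V` at a position where the two differ. Both attain `V` equally
often, so each attains it somewhere the other does not, and there the other is smaller by
maximality. -/
theorem exists_swap_of_perm_ne {y : Fin n → ℝ} {σ τ : Equiv.Perm (Fin n)} (h : y ∘ σ ≠ y ∘ τ) :
    ∃ i j, y (σ i) = y (τ j) ∧ y (τ i) < y (σ i) ∧ y (σ j) < y (τ j) := by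
  have key : ∀ (σ τ : Equiv.Perm (Fin n)) (k : Fin n), y (τ k) < y (σ k) →
      (∀ l, y (σ l) ≠ y (τ l) → max (y (σ l)) (y (τ l)) ≤ y (σ k)) →
      ∃ i j, y (σ i) = y (τ j) ∧ y (τ i) < y (σ i) ∧ y (σ j) < y (τ j) := by
    intro σ τ k hk hmax
    have hcard : ∀ ρ : Equiv.Perm (Fin n),
        (Finset.univ.filter fun l => y (ρ l) = y (σ k)).card =
          (Finset.univ.filter fun l => y l = y (σ k)).card := fun ρ =>
      Finset.card_equiv ρ (by simp)
    obtain ⟨j, hj1, hj2⟩ : ∃ j, y (τ j) = y (σ k) ∧ y (σ j) ≠ y (σ k) := by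
      by_contra! hcon
      have hsub : (Finset.univ.filter fun l => y (τ l) = y (σ k)) ⊂
          Finset.univ.filter fun l => y (σ l) = y (σ k) := by
        refine Finset.ssubset_iff_of_subset (fun l hl => ?_) |>.2 ⟨k, by simp, by simp [hk.ne]⟩
        simp only [Finset.mem_filter, Finset.mem_univ, true_and] at hl ⊢
        exact hcon l hl
      have := Finset.card_lt_card hsub
      rw [hcard, hcard] at this
      exact lt_irrefl _ this
    refine ⟨k, j, hj1.symm, hk, ?_⟩
    have := (le_max_left _ _).trans (hmax j (by rwa [hj1]))
    rw [hj1]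
    exact lt_of_le_of_ne this hj2
  obtain ⟨k0, hk0⟩ := Function.ne_iff.1 h
  obtain ⟨k, hk, hmax⟩ := Finset.exists_max_image
    (Finset.univ.filter fun l => y (σ l) ≠ y (τ l)) (fun l => max (y (σ l)) (y (τ l)))
    ⟨k0, by simpa using hk0⟩
  simp only [Finset.mem_filter, Finset.mem_univ, true_and] at hk hmax
  rcases lt_or_gt_of_ne hk with hlt | hlt
  · obtain ⟨i, j, h1, h2, h3⟩ := key τ σ k hlt fun l hl => by
      rw [max_comm]
      exact (hmax l hl.symm).trans_eq (max_eq_right hlt.le)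
    exact ⟨j, i, h1.symm, h3, h2⟩
  · exact key σ τ k hlt fun l hl => (hmax l hl).trans_eq (max_eq_left hlt.le)

end TwoLevel

/-! ### Three inner directions and the facial dimension -/

section Faces

variable {n : ℕ}

/-- The midpoint of `x` and `y` can move along `-z` by moving `x` and along `z` by moving `y`, and
its inner directions are inner at `m`. -/
theorem mem_innerDirections_of_pairs {E : Type*} [AddCommGroup E] [Module ℝ E] {K : Set E}
    (hK : Convex ℝ K) {m x y z : E} (hm : m ∈ K) (hx : x ∈ K) (hy : y ∈ K)
    (hxm : x - m ∈ hK.innerDirections hm) (hym : y - m ∈ hK.innerDirections hm) {a b : ℝ}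
    (ha : 0 < a) (hb : 0 < b) (hxz : x - a • z ∈ K) (hyz : y + b • z ∈ K) :
    z ∈ hK.innerDirections hm := by
  have hmid : (1 / 2 : ℝ) • x + (1 / 2 : ℝ) • y ∈ K :=
    hK hx hy (by norm_num) (by norm_num) (by norm_num)
  refine hK.innerDirections_le hm hmid ?_ ?_
  · have := Submodule.smul_mem _ (1 / 2 : ℝ) (Submodule.add_mem _ hxm hym)
    convert this using 1
    module
  · have hs : 0 < min a b := lt_min ha hb
    have h1 : x + min a b • (-z) ∈ K :=
      hK.add_smul_mem_of_le hx (by simpa [sub_eq_add_neg] using hxz) hs.le (min_le_left _ _)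
    have h2 : y + min a b • z ∈ K := hK.add_smul_mem_of_le hy hyz hs.le (min_le_right _ _)
    refine ⟨min a b / 2, half_pos hs, ?_, ?_⟩
    · convert hK hx h2 (show (0 : ℝ) ≤ 1 / 2 by norm_num) (show (0 : ℝ) ≤ 1 / 2 by norm_num)
        (by norm_num) using 1
      module
    · convert hK h1 hy (show (0 : ℝ) ≤ 1 / 2 by norm_num) (show (0 : ℝ) ≤ 1 / 2 by norm_num)
        (by norm_num) using 1
      module

theorem comp_swap_eq (x : Fin n → ℝ) {i j : Fin n} (hij : i ≠ j) :
    x ∘ Equiv.swap i j = x - (x i - x j) • (Pi.single i 1 - Pi.single j 1) := by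
  ext k
  by_cases h1 : k = i
  · subst h1; simp [hij]
  · by_cases h2 : k = j
    · subst h2; simp [hij.symm]
    · simp [Equiv.swap_apply_of_ne_of_ne h1 h2, h1, h2]

theorem exists_linearIndependent_innerDirections_diagonal {x y : Fin n → ℝ}
    (hx : x ∈ convexHull ℝ (Set.range fun σ : Equiv.Perm (Fin n) => y ∘ σ))
    (hxy : ∀ σ : Equiv.Perm (Fin n), x ≠ y ∘ σ)
    (hm : realDiagonal n x ∈ convexHull ℝ (unitaryOrbit (realDiagonal n y))) :
    ∃ d : Fin 3 → Matrix (Fin n) (Fin n) ℂ, LinearIndependent ℝ d ∧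
      ∀ k, d k ∈ (convex_convexHull ℝ (unitaryOrbit (realDiagonal n y))).innerDirections hm := by
  set K := convexHull ℝ (unitaryOrbit (realDiagonal n y)) with hKdef
  have hK : Convex ℝ K := convex_convexHull ℝ _
  have hperm : ∀ σ : Equiv.Perm (Fin n), realDiagonal n (y ∘ σ) ∈ K := fun σ =>
    subset_convexHull ℝ _ (realDiagonal_perm_mem_unitaryOrbit y σ)
  obtain ⟨ι, _, w, z, hw0, hw1, hz, hsum⟩ := mem_convexHull_iff_exists_fintype.1 hx
  choose ρ hρ using hz
  have hzT : ∀ l, 0 < w l → realDiagonal n (y ∘ ρ l) - realDiagonal n x ∈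
      hK.innerDirections hm := fun l hl => by
    refine hK.sub_mem_innerDirections_of_sum_eq hm hw0 hw1 (z := fun l => realDiagonal n (y ∘ ρ l))
      (fun l => hperm (ρ l)) ?_ hl
    rw [← hsum, map_sum]
    refine Finset.sum_congr rfl fun l _ => ?_
    rw [map_smul, ← hρ l]
  obtain ⟨l, hl⟩ : ∃ l, 0 < w l := by
    by_contra! h
    have := Finset.sum_nonpos fun l (_ : l ∈ Finset.univ) => h l
    linarith
  obtain ⟨l', hl', hne⟩ : ∃ l', 0 < w l' ∧ y ∘ ρ l ≠ y ∘ ρ l' := by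
    by_contra! h
    refine hxy (ρ l) ?_
    rw [← hsum]
    have : ∀ l', w l' • z l' = w l' • (y ∘ ρ l) := fun l' => by
      rcases (hw0 l').eq_or_lt with h0 | h0
      · rw [← h0, zero_smul, zero_smul]
      · rw [h l' h0, ← hρ l']
    simp only [this]
    rw [← Finset.sum_smul, hw1, one_smul]
  obtain ⟨i, j, h1, h2, h3⟩ := exists_swap_of_perm_ne hne
  have hij : i ≠ j := by
    rintro rfl
    linarith
  set α := y ∘ ρ l with hα
  set β := y ∘ ρ l' with hβ
  have ha : 0 < α i - α j := by simp only [hα, Function.comp_apply]; linarith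
  have hb : 0 < β j - β i := by simp only [hβ, Function.comp_apply]; linarith
  set Z := realDiagonal n (Pi.single i 1 - Pi.single j 1) with hZ
  have hα' : realDiagonal n α - (α i - α j) • Z ∈ K := by
    rw [hZ, ← map_smul, ← map_sub (realDiagonal n) α, ← comp_swap_eq α hij]
    exact hperm (Equiv.swap i j |>.trans (ρ l))
  have hβ' : realDiagonal n β + (β j - β i) • Z ∈ K := by
    have h : β + (β j - β i) • (Pi.single i 1 - Pi.single j 1) = β ∘ Equiv.swap i j := by
      rw [comp_swap_eq β hij]
      module
    rw [hZ, ← map_smul, ← map_add, h]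
    exact hperm (Equiv.swap i j |>.trans (ρ l'))
  have hZT : Z ∈ hK.innerDirections hm :=
    mem_innerDirections_of_pairs hK hm (hperm _) (hperm _) (hzT l hl) (hzT l' hl') ha hb hα' hβ'
  -- The midpoint of `α` and its swap, centre of the Bloch ball in the `(i, j)` block.
  set O := realDiagonal n α - ((α i - α j) / 2) • Z with hO
  have hOK : O ∈ K := by
    rw [hO, sub_eq_add_neg, ← smul_neg]
    refine hK.add_smul_mem_of_le (hperm _) (ε := α i - α j) ?_ (by linarith) (by linarith)
    rwa [smul_neg, ← sub_eq_add_neg]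
  have hOT : hK.innerDirections hOK ≤ hK.innerDirections hm := by
    refine hK.innerDirections_le hm hOK ?_
    have := Submodule.sub_mem _ (hzT l hl) (Submodule.smul_mem _ ((α i - α j) / 2) hZT)
    convert this using 1
    rw [hO]
    abel
  have horb : ∀ ζ : ℂ, ζ * star ζ = 1 → O + ((α i - α j) / 2) • offDiagonalPair i j ζ ∈ K :=
    fun ζ hζ => by
      rw [hKdef, ← unitaryOrbit_eq_of_mem (realDiagonal_perm_mem_unitaryOrbit y (ρ l))]
      exact subset_convexHull ℝ _ (diagonal_add_offDiagonalPair_mem_unitaryOrbit α hij hζ)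
  have hXT : ∀ ζ : ℂ, ζ * star ζ = 1 → offDiagonalPair i j ζ ∈ hK.innerDirections hm :=
    fun ζ hζ => hOT ⟨(α i - α j) / 2, by linarith, horb ζ hζ, by
      rw [← offDiagonalPair_neg]
      exact horb (-ζ) (by simpa using hζ)⟩
  refine ⟨_, linearIndependent_twoLevel hij, fun k => ?_⟩
  fin_cases k
  · exact hZT
  · exact hXT 1 (by simp)
  · exact hXT Complex.I (by simp)

theorem exists_linearIndependent_innerDirections {c m : Matrix (Fin n) (Fin n) ℂ}
    (hc : c.IsHermitian) (hm : m ∈ convexHull ℝ (unitaryOrbit c)) (hmc : m ∉ unitaryOrbit c) :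
    ∃ d : Fin 3 → Matrix (Fin n) (Fin n) ℂ, LinearIndependent ℝ d ∧
      ∀ k, d k ∈ (convex_convexHull ℝ (unitaryOrbit c)).innerDirections hm := by
  have hmh := isHermitian_of_mem_convexHull hc hm
  obtain ⟨u, hu, h⟩ := hmh.exists_eq_conjLinear
  set x := hmh.sortedEigenvalues with hxdef
  set y := hc.sortedEigenvalues with hydef
  have hxm : realDiagonal n x ∈ convexHull ℝ (unitaryOrbit (realDiagonal n y)) := by
    rw [← hc.unitaryOrbit_eq, ← conjLinear_mem_convexHull_iff hu, ← h]
    exact hm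
  have hmaj := (realDiagonal_mem_convexHull_iff hmh.sortedEigenvalues_antitone
    hc.sortedEigenvalues_antitone).1 hxm
  have hx := mem_convexHull_perm_of_majorized hmh.sortedEigenvalues_antitone hmaj.1 hmaj.2
  have hxy : ∀ σ : Equiv.Perm (Fin n), x ≠ y ∘ σ := fun σ hσ => hmc <| by
    rw [h, conjLinear_mem_unitaryOrbit_iff hu, hc.unitaryOrbit_eq, hσ]
    exact realDiagonal_perm_mem_unitaryOrbit y σ
  obtain ⟨d, hd, hdT⟩ := exists_linearIndependent_innerDirections_diagonal hx hxy hxm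
  refine ⟨conjLinear u ∘ d, hd.map' _ (LinearMap.ker_eq_bot.2 <|
    Function.LeftInverse.injective (conjLinear_star_conjLinear hu)), fun k => ?_⟩
  obtain ⟨ε, hε, h1, h2⟩ := hdT k
  have key : ∀ e, realDiagonal n x + ε • e ∈ convexHull ℝ (unitaryOrbit (realDiagonal n y)) →
      m + ε • conjLinear u e ∈ convexHull ℝ (unitaryOrbit c) := fun e he => by
    have hme : m + ε • conjLinear u e = conjLinear u (realDiagonal n x + ε • e) := by
      rw [map_add, map_smul, ← h]
    rw [hme, conjLinear_mem_convexHull_iff hu, hc.unitaryOrbit_eq]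
    exact he
  refine ⟨ε, hε, key _ h1, ?_⟩
  rw [Function.comp_apply, ← map_neg]
  exact key _ h2

theorem trace_sq_eq_of_mem_unitaryOrbit {c a : Matrix (Fin n) (Fin n) ℂ}
    (ha : a ∈ unitaryOrbit c) : (a * a).trace = (c * c).trace := by
  obtain ⟨u, hu, rfl⟩ := ha
  have : star u * c * u * (star u * c * u) = star u * (c * c * u) := by
    have := mem_unitaryGroup_iff.1 hu
    calc _ = star u * c * (u * star u) * c * u := by simp only [mul_assoc]
      _ = _ := by rw [this]; simp only [mul_assoc, mul_one]
  rw [this, trace_mul_comm, mul_assoc, mem_unitaryGroup_iff.1 hu, mul_one]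

open scoped ComplexOrder in
-- `tr (a²)` is constant on the orbit; if the midpoint had the same value, the parallelogram
-- identity would give `tr ((p - q)²) = 0`.
theorem midpoint_notMem_unitaryOrbit {c p q : Matrix (Fin n) (Fin n) ℂ} (hc : c.IsHermitian)
    (hp : p ∈ unitaryOrbit c) (hq : q ∈ unitaryOrbit c) (hpq : p ≠ q) :
    (1 / 2 : ℝ) • p + (1 / 2 : ℝ) • q ∉ unitaryOrbit c := by
  intro hm
  have hH : (p - q).IsHermitian :=
    (isHermitian_of_mem_convexHull hc (subset_convexHull ℝ _ hp)).sub
      (isHermitian_of_mem_convexHull hc (subset_convexHull ℝ _ hq))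
  have h1 := trace_sq_eq_of_mem_unitaryOrbit hp
  have h2 := trace_sq_eq_of_mem_unitaryOrbit hq
  have h3 := trace_sq_eq_of_mem_unitaryOrbit hm
  have hexp : (p - q) * (p - q) = (2 : ℝ) • (p * p) + (2 : ℝ) • (q * q) -
      (4 : ℝ) • (((1 / 2 : ℝ) • p + (1 / 2 : ℝ) • q) * ((1 / 2 : ℝ) • p + (1 / 2 : ℝ) • q)) := by
    simp only [mul_add, add_mul, mul_sub, sub_mul, smul_mul_assoc, mul_smul_comm]
    module
  have h0 : ((p - q)ᴴ * (p - q)).trace = 0 := by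
    rw [hH.eq, hexp, trace_sub, trace_add, trace_smul, trace_smul, trace_smul, h1, h2, h3]
    module
  exact hpq (sub_eq_zero.1 (trace_conjTranspose_mul_self_eq_zero_iff.1 h0))

theorem three_le_affineDim_of_face {c : Matrix (Fin n) (Fin n) ℂ} (hc : c.IsHermitian)
    {Q : Set (Matrix (Fin n) (Fin n) ℂ)} (hQ : IsConvexFace (convexHull ℝ (unitaryOrbit c)) Q)
    (hnt : Q.Nontrivial) : 3 ≤ affineDim Q := by
  obtain ⟨m, hmQ, hm⟩ : ∃ m ∈ Q, m ∉ unitaryOrbit c := by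
    by_contra! h
    obtain ⟨p, hp, q, hq, hpq⟩ := hnt
    exact midpoint_notMem_unitaryOrbit hc (h p hp) (h q hq) hpq
      (h _ (hQ.convex hp hq (by norm_num) (by norm_num) (by norm_num)))
  obtain ⟨d, hd, hdT⟩ :=
    exists_linearIndependent_innerDirections hc (hQ.extreme.subset hmQ) hm
  have hdQ : ∀ k, d k ∈ vectorSpan ℝ Q := fun k =>
    (convex_convexHull ℝ _).innerDirections_le_vectorSpan hQ.extreme _ hmQ (hdT k)
  have hli : LinearIndependent ℝ fun k => (⟨d k, hdQ k⟩ : vectorSpan ℝ Q) :=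
    LinearIndependent.of_comp (vectorSpan ℝ Q).subtype hd
  have := hli.cardinal_le_rank
  rw [Cardinal.mk_fin] at this
  have h2 := Cardinal.toENat.monotone' this
  simpa [affineDim] using h2

theorem three_le_facialDim {c : Matrix (Fin n) (Fin n) ℂ} (hc : c.IsHermitian) :
    3 ≤ facialDim (convexHull ℝ (unitaryOrbit c)) := by
  refine le_sInf ?_
  rintro _ ⟨Q, hQ, hnt, rfl⟩
  exact three_le_affineDim_of_face hc hQ hnt

/-! ### Compactness of the hull and convexity of the numerical range -/

/-- Imposing the Ky Fan bounds on the diagonals of all unitary conjugates gives closed conditions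
without mention of eigenvalues; a diagonalising conjugate recovers majorization. -/
theorem isClosed_convexHull_unitaryOrbit {c : Matrix (Fin n) (Fin n) ℂ} (hc : c.IsHermitian) :
    IsClosed (convexHull ℝ (unitaryOrbit c)) := by
  set y := hc.sortedEigenvalues
  have hset : convexHull ℝ (unitaryOrbit c) =
      {a | a.IsHermitian} ∩ ⋂ u ∈ unitaryGroup (Fin n) ℂ, ⋂ k : ℕ, ⋂ _ : k ≤ n,
        {a | ∑ i with i.val < k, (conjLinear u a i i).re ≤ ∑ i with i.val < k, y i} ∩
        {a | a.trace = c.trace} := by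
    ext a
    simp only [Set.mem_inter_iff, Set.mem_iInter, Set.mem_ofPred_eq]
    constructor
    · intro h
      refine ⟨isHermitian_of_mem_convexHull hc h, fun u hu k hk => ⟨?_, trace_eq_of_mem_convexHull h⟩⟩
      refine sum_re_diag_le hc.sortedEigenvalues_antitone ?_ hk
      rw [← hc.unitaryOrbit_eq]
      exact conjLinear_mem_convexHull h hu
    · rintro ⟨ha, h⟩
      obtain ⟨u, hu, hau⟩ := ha.exists_eq_conjLinear
      have hau' : conjLinear (star u) a = realDiagonal n ha.sortedEigenvalues := by
        conv_lhs => rw [hau]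
        exact conjLinear_star_conjLinear hu _
      rw [hau, conjLinear_mem_convexHull_iff hu, hc.unitaryOrbit_eq,
        realDiagonal_mem_convexHull_iff ha.sortedEigenvalues_antitone hc.sortedEigenvalues_antitone]
      refine ⟨fun k hk => ?_, ?_⟩
      · have := (h (star u) (Unitary.star_mem hu) k hk).1
        rw [hau'] at this
        simpa [realDiagonal_apply] using this
      · have h1 := (h (star u) (Unitary.star_mem hu) 0 (Nat.zero_le _)).2
        have h2 : ∀ {b : Matrix (Fin n) (Fin n) ℂ} (hb : b.IsHermitian),
            b.trace = ((∑ i, hb.sortedEigenvalues i : ℝ) : ℂ) := fun {b} hb => by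
          obtain ⟨v, hv, hbv⟩ := hb.exists_eq_conjLinear
          have h3 := trace_eq_of_mem_convexHull (subset_convexHull ℝ _
            (show b ∈ unitaryOrbit (realDiagonal n hb.sortedEigenvalues) from ⟨v, hv, hbv⟩))
          rw [h3, realDiagonal_apply, trace_diagonal]
          push_cast
          rfl
        rw [h2 ha, h2 hc] at h1
        exact_mod_cast h1
  rw [hset]
  refine IsClosed.inter (isClosed_eq (by fun_prop) continuous_id) ?_
  refine isClosed_biInter fun u _ => isClosed_iInter fun k => isClosed_iInter fun _ => ?_
  refine IsClosed.inter (isClosed_le ?_ continuous_const) (isClosed_eq (by fun_prop) continuous_const)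
  refine continuous_finsetSum _ fun i _ => Complex.continuous_re.comp ?_
  simp only [conjLinear_apply]
  exact Continuous.matrix_elem (by fun_prop) i i

theorem isCompact_convexHull_unitaryOrbit {c : Matrix (Fin n) (Fin n) ℂ} (hc : c.IsHermitian) :
    IsCompact (convexHull ℝ (unitaryOrbit c)) := by
  set C := ∑ k, ∑ l, ‖c k l‖
  have hcomp : IsCompact (Set.univ.pi fun _ : Fin n => Set.univ.pi fun _ : Fin n =>
      Metric.closedBall (0 : ℂ) C : Set (Matrix (Fin n) (Fin n) ℂ)) :=
    isCompact_univ_pi fun _ => isCompact_univ_pi fun _ => isCompact_closedBall _ _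
  refine hcomp.of_isClosed_subset (isClosed_convexHull_unitaryOrbit hc) (convexHull_min ?_
    (convex_pi fun _ _ => convex_pi fun _ _ => convex_closedBall _ _))
  rintro _ ⟨u, hu, rfl⟩ i - j -
  rw [mem_closedBall_zero_iff]
  have hle : ∀ k l, ‖u k l‖ ≤ 1 := entry_norm_bound_of_unitary hu
  rw [mul_apply]
  simp only [mul_apply, Finset.sum_mul]
  rw [Finset.sum_comm]
  refine (norm_sum_le _ _).trans (Finset.sum_le_sum fun k _ => (norm_sum_le _ _).trans
    (Finset.sum_le_sum fun l _ => ?_))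
  rw [norm_mul, norm_mul, star_apply, norm_star]
  calc ‖u k i‖ * ‖c k l‖ * ‖u l j‖ ≤ 1 * ‖c k l‖ * 1 := by
        gcongr <;> exact hle _ _
    _ = _ := by ring

theorem exists_ne_zero_mem_ker {V : Type*} [AddCommGroup V] [Module ℝ V] {d : Fin 3 → V}
    (hd : LinearIndependent ℝ d) (f : V →ₗ[ℝ] ℂ) {T : Submodule ℝ V} (hT : ∀ k, d k ∈ T) :
    ∃ v ∈ T, v ≠ 0 ∧ f v = 0 := by
  have hnot : ¬ LinearIndependent ℝ (f ∘ d) := fun h => by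
    have := h.fintype_card_le_finrank
    rw [Complex.finrank_real_complex, Fintype.card_fin] at this
    omega
  obtain ⟨g, hg, k, hk⟩ := Fintype.not_linearIndependent_iff.1 hnot
  refine ⟨∑ i, g i • d i, Submodule.sum_mem _ fun i _ => Submodule.smul_mem _ _ (hT i), ?_, ?_⟩
  · exact fun h => hk (Fintype.linearIndependent_iff.1 hd g h k)
  · simpa using hg

/-- **Lyapunov-type theorem**: a linear map to the plane takes the same values on the unitary
orbit of a Hermitian matrix as on its convex hull. -/
theorem image_unitaryOrbit_eq_image_convexHull {c : Matrix (Fin n) (Fin n) ℂ} (hc : c.IsHermitian)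
    (f : Matrix (Fin n) (Fin n) ℂ →ₗ[ℝ] ℂ) (hf : Continuous f) :
    f '' unitaryOrbit c = f '' convexHull ℝ (unitaryOrbit c) := by
  refine (Set.image_mono (subset_convexHull ℝ _)).antisymm ?_
  rintro _ ⟨a, ha, rfl⟩
  have : LocallyConvexSpace ℝ (Matrix (Fin n) (Fin n) ℂ) :=
    inferInstanceAs (LocallyConvexSpace ℝ (Fin n → Fin n → ℂ))
  have hcomp : IsCompact (convexHull ℝ (unitaryOrbit c) ∩ f ⁻¹' {f a}) :=
    (isCompact_convexHull_unitaryOrbit hc).inter_right (isClosed_singleton.preimage hf)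
  obtain ⟨k, hk⟩ := hcomp.extremePoints_nonempty (E := Matrix (Fin n) (Fin n) ℂ) ⟨a, ha, rfl⟩
  obtain ⟨⟨hkK, hkf⟩, hext⟩ := mem_extremePoints.1 hk
  refine ⟨k, ?_, hkf⟩
  by_contra hkc
  obtain ⟨d, hd, hdT⟩ := exists_linearIndependent_innerDirections hc hkK hkc
  -- Since `dim_ℝ ℂ = 2 < 3`, some nonzero inner direction keeps `f` fixed, so `k` is a midpoint
  -- inside its fibre, against extremality.
  obtain ⟨v, ⟨ε, hε, h1, h2⟩, hv0, hfv⟩ := exists_ne_zero_mem_ker hd f hdT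
  have := (hext _ ⟨h1, by simpa [hfv] using hkf⟩ _ ⟨h2, by simpa [hfv] using hkf⟩
    ⟨1 / 2, 1 / 2, by norm_num, by norm_num, by norm_num, by module⟩).1
  simp [hε.ne', hv0] at this

theorem cNumericalRange_eq_image (c b : Matrix (Fin n) (Fin n) ℂ) :
    cNumericalRange c b = (fun a => (b * a).trace) '' unitaryOrbit c := by
  ext z
  constructor
  · rintro ⟨u, hu, rfl⟩
    refine ⟨_, ⟨star u, Unitary.star_mem hu, rfl⟩, ?_⟩
    rw [star_star, mul_assoc (c * star u), trace_mul_comm (c * star u), mul_assoc, mul_assoc]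
  · rintro ⟨_, ⟨u, hu, rfl⟩, rfl⟩
    refine ⟨star u, Unitary.star_mem hu, ?_⟩
    rw [star_star, mul_assoc (c * u), trace_mul_comm (c * u), mul_assoc, mul_assoc]

/-- **Westwick's theorem**: the `c`-numerical range of a matrix is convex for `c` Hermitian. -/
theorem convex_cNumericalRange {c : Matrix (Fin n) (Fin n) ℂ} (hc : c.IsHermitian)
    (b : Matrix (Fin n) (Fin n) ℂ) : Convex ℝ (cNumericalRange c b) := by
  let f : Matrix (Fin n) (Fin n) ℂ →ₗ[ℝ] ℂ :=
    traceLinearMap (Fin n) ℝ ℂ ∘ₗ LinearMap.mulLeft ℝ b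
  have hf : Continuous f := show Continuous fun a => (b * a).trace by fun_prop
  rw [cNumericalRange_eq_image]
  change Convex ℝ (f '' unitaryOrbit c)
  rw [image_unitaryOrbit_eq_image_convexHull hc f hf]
  exact (convex_convexHull ℝ _).linear_image f

end Faces

theorem proposition3 (n : ℕ) (c : Matrix (Fin n) (Fin n) ℂ) (hc : c.IsHermitian) :
    (∀ b : Matrix (Fin n) (Fin n) ℂ, Convex ℝ (cNumericalRange c b)) ∧
    convexHull ℝ (unitaryOrbit c) =
      {a : Matrix (Fin n) (Fin n) ℂ | ∃ ha : a.IsHermitian, EigenvaluesMajorizedBy ha hc} ∧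
    3 ≤ facialDim (convexHull ℝ (unitaryOrbit c)) :=
  ⟨convex_cNumericalRange hc, convexHull_unitaryOrbit_eq hc, three_le_facialDim hc⟩
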